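/- Let $\overline{\mathbb{Q}}\subset\mathbb{C}$ be the field of algebraic numbers. For an algebraic integer $\alpha\neq 0$ let $\mathrm{M}(\alpha)$ be its Mahler measure, let its house $\overline{|\alpha|}$ be the maximum modulus of its conjugates, and let $$\mu_\alpha=\frac{1}{\deg\alpha}\sum_{\sigma}\delta_{\sigma(\alpha)},$$ the sum being over all embeddings $\sigma:\mathbb{Q}(\alpha)\to\mathbb{C}$, a probability measure on $\mathbb{C}^\times$. For $n\ge 2$ let $\theta_n$ be the unique root in $(0,1)$ of $-1+z+z^n$. The dynamical degree $\mathrm{dyg}(\beta)$ of a real number $1<\beta<\frac{1+\sqrt5}{2}=\theta_2^{-1}$ is the unique integer $n\ge 3$ with $\theta_n^{-1}\le\beta<\theta_{n-1}^{-1}$; moreover $\mathrm{dyg}(\theta_2^{-1})=2$. Put $\mathrm{dyg}(\alpha)=\mathrm{dyg}(\overline{|\alpha|})$ when $1<\overline{|\alpha|}\le\frac{1+\sqrt5}{2}$. Let $\Theta=1.3247\ldots$ be the smallest Pisot number, and let $\mu_{\mathbb{T}}$ be the normalized Haar measure of the unit circle $\mathbb{T}$, regarded as a measure on $\mathbb{C}^\times$.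 A sequence in $\overline{\mathbb{Q}}^\times$ is called strict if every proper algebraic (Zariski closed) subgroup of $\overline{\mathbb{Q}}^\times=\mathbb{G}_m(\overline{\mathbb{Q}})$ contains only finitely many of its terms (counted by index). Theorem. Let $(\alpha_q)_{q\ge1}$ be a sequence of algebraic integers such that, for every $q\ge 1$, $|\alpha_q|>1$, $\mathrm{M}(\alpha_q)<\Theta$, and $\mathrm{dyg}(\alpha_q)$ is defined and $\ge 260$, with $\lim_{q\to\infty}\overline{|\alpha_q|}=1$. Then the sequence $(\alpha_q)$ is strict, $\mathrm{dyg}(\alpha_q)\to+\infty$, and $\mu_{\alpha_q}\to\mu_{\mathbb{T}}$ weakly as $q\to\infty$ (equivalently, as $\mathrm{dyg}(\alpha_q)\to+\infty$), i.e. for all bounded continuous functions $f:\mathbb{C}^\times\to\mathbb{C}$, $$\int f\,d\mu_{\alpha_q}\longrightarrow\int f\,d\mu_{\mathbb{T}} .$$ -/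

import Mathlib

open MeasureTheory Filter Topology Polynomial IntermediateField
open scoped BoundedContinuousFunction ENNReal

noncomputable section

namespace SmallMahler

/-- The field of algebraic numbers in `ℂ`. -/
abbrev QBar : IntermediateField ℚ ℂ := algebraicClosure ℚ ℂ

/-- The house of an algebraic number: the maximum modulus of its conjugates (the complex roots of
its minimal polynomial over `ℚ`), including itself. -/
def house (a : ℂ) : ℝ := ⨆ z : (minpoly ℚ a).rootSet ℂ, ‖(z : ℂ)‖

/-- The Mahler measure of an algebraic integer, i.e. of its (monic) minimal polynomial over `ℤ`. -/
def mahler (a : ℂ) : ℝ := ((minpoly ℤ a).map (Int.castRingHom ℂ)).mahlerMeasure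

/-- A Pisot number: a real algebraic integer `> 1` all of whose other conjugates have
modulus `< 1`. -/
def IsPisot (x : ℝ) : Prop :=
  1 < x ∧ IsIntegral ℤ x ∧ ∀ z ∈ (minpoly ℚ x).rootSet ℂ, z ≠ (x : ℂ) → ‖z‖ < 1

/-- The smallest Pisot number `Θ = 1.3247…`. -/
def smallestPisot : ℝ := sInf {x : ℝ | IsPisot x}

/-- The trinomial `-1 + z + z ^ n` has exactly one root in `(0, 1)` when `n ≥ 1`. -/
theorem existsUnique_trinomial_root (n : ℕ) (hn : 1 ≤ n) :
    ∃! z : ℝ, z ∈ Set.Ioo (0 : ℝ) 1 ∧ -1 + z + z ^ n = 0 := by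
  have hc : ContinuousOn (fun z : ℝ => -1 + z + z ^ n) (Set.Icc 0 1) := by fun_prop
  have h0 : (0 : ℝ) ^ n = 0 := zero_pow (by omega)
  have h := intermediate_value_Ioo (zero_le_one (α := ℝ)) hc
  have hm : (0 : ℝ) ∈ Set.Ioo (-1 + 0 + (0 : ℝ) ^ n) (-1 + 1 + (1 : ℝ) ^ n) := by
    rw [h0, one_pow]; norm_num
  obtain ⟨z, hz, hz0⟩ := h hm
  refine ⟨z, ⟨hz, hz0⟩, ?_⟩
  rintro y ⟨hy, hy0⟩
  simp only at hz0
  rcases lt_trichotomy y z with hlt | heq | hgt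
  · have := pow_le_pow_left₀ hy.1.le hlt.le n
    linarith
  · exact heq
  · have := pow_le_pow_left₀ hz.1.le hgt.le n
    linarith

/-- `θ_n`, for `n ≥ 1`: the unique root in `(0, 1)` of the trinomial `-1 + z + z ^ n`. -/
def theta (n : ℕ) : ℝ := sInf {z : ℝ | z ∈ Set.Ioo (0 : ℝ) 1 ∧ -1 + z + z ^ n = 0}

theorem theta_spec (n : ℕ) (hn : 1 ≤ n) :
    theta n ∈ Set.Ioo (0 : ℝ) 1 ∧ -1 + theta n + theta n ^ n = 0 := by
  obtain ⟨z, hz, hu⟩ := existsUnique_trinomial_root n hn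
  have hs : {z : ℝ | z ∈ Set.Ioo (0 : ℝ) 1 ∧ -1 + z + z ^ n = 0} = {z} := by
    ext y
    exact ⟨fun hy => hu y hy, fun hy => by rw [Set.mem_singleton_iff.1 hy]; exact hz⟩
  have ht : theta n = z := by rw [theta, hs, csInf_singleton]
  rw [ht]
  exact hz

open Classical in
/-- The dynamical degree of a real number `1 < b ≤ (1 + √5) / 2`: the unique `n ≥ 3` such that
`θ_n⁻¹ ≤ b < θ_{n-1}⁻¹`, and `2` for the golden ratio. Outside of that range there is no such `n`,
and the value is `0`. -/
def dygReal (b : ℝ) : ℕ :=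
  if b = Real.goldenRatio then 2
  else sInf {n : ℕ | 3 ≤ n ∧ (theta n)⁻¹ ≤ b ∧ b < (theta (n - 1))⁻¹}

/-- The dynamical degree of an algebraic number is that of its house. -/
def dyg (a : ℂ) : ℕ := dygReal (house a)

/-- The topological and measurable structures on `ℂˣ` are both induced by the inclusion in `ℂ`. -/
instance borelSpaceUnits : BorelSpace ℂˣ where
  measurable_eq := by
    have h : Units.instMeasurableSpace (M := ℂ) = (borel ℂ).comap Units.val := by
      rw [← BorelSpace.measurable_eq (α := ℂ)]; rfl
    rw [h, Units.isEmbedding_val₀.eq_induced, borel_comap]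

/-- The image of `a` under an embedding `σ : ℚ(a) → ℂ`, as an element of `ℂˣ`. -/
def conj (a : QBarˣ) (σ : ℚ⟮((a : QBar) : ℂ)⟯ →ₐ[ℚ] ℂ) : ℂˣ :=
  Units.mk0 (σ (AdjoinSimple.gen ℚ ((a : QBar) : ℂ))) (by
    intro h
    have h1 : AdjoinSimple.gen ℚ ((a : QBar) : ℂ) = 0 := (map_eq_zero σ).1 h
    have h2 : ((a : QBar) : ℂ) = 0 := by
      rw [← AdjoinSimple.coe_gen ℚ ((a : QBar) : ℂ), h1]; rfl
    exact a.ne_zero (Subtype.ext h2))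

/-- The Galois orbit measure `μ_a = (1 / deg a) ∑_σ δ_{σ(a)}` on `ℂˣ`, the sum being over all
embeddings `σ : ℚ(a) → ℂ`. -/
def galoisMeasure (a : QBarˣ) : Measure ℂˣ :=
  ((minpoly ℚ ((a : QBar) : ℂ)).natDegree : ℝ≥0∞)⁻¹ •
    Measure.sum fun σ : ℚ⟮((a : QBar) : ℂ)⟯ →ₐ[ℚ] ℂ => Measure.dirac (conj a σ)

/-- The normalized Haar measure of the unit circle, as a measure on `ℂˣ`: the image of the Haar
probability measure of `ℝ / ℤ` under `t ↦ exp (2 π i t)`. -/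
def haarCircle : Measure ℂˣ :=
  (AddCircle.haarAddCircle (T := 1)).map
    fun t : AddCircle (1 : ℝ) => Circle.toUnits (AddCircle.toCircle t)

/-- An algebraic (that is, Zariski closed) subgroup of the multiplicative group of `QBar`. -/
def IsAlgebraicSubgroup (H : Subgroup QBarˣ) : Prop :=
  ∃ S : Set (QBar[X]), ∀ x : QBarˣ, x ∈ H ↔ ∀ p ∈ S, p.eval (x : QBar) = 0

/-- A sequence of nonzero algebraic numbers is strict if every proper algebraic subgroup of the
multiplicative group contains only finitely many of its terms. -/
def IsStrict (γ : ℕ → QBarˣ) : Prop :=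
  ∀ H : Subgroup QBarˣ, IsAlgebraicSubgroup H → H ≠ ⊤ → {q : ℕ | γ q ∈ H}.Finite

end SmallMahler

end

noncomputable section

namespace SmallMahler

/-! ### The logarithmic energy of a finite family of complex numbers -/

/-! The convergence of measures is Bilu's equidistribution, obtained here from an energy estimate.
Let `d` be the degree and `M` the Mahler measure. The discriminant is a nonzero integer, so the
product of the differences of conjugates is at least 1 in modulus. After reflecting the conjugates
into the unit disc, each difference is bounded by a kernel `‖1 - r z w̄‖`, at a cost governed by `M`
and `r`. The resulting energy `-∑ log ‖1 - r z w̄‖` expands as `∑ rⁿ/n ‖∑ zⁿ‖²`, a series of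
nonnegative terms, so each power sum is controlled (`norm_sum_discReflect_pow_sq_le`). With `r = 1 -
1/d` the averages of powers tend to 0 as `d → ∞`.

The norm is a nonzero integer too, so `∑ |log ‖x‖| ≤ 2 log M`: most conjugates lie near the circle,
and Weyl's criterion concludes (`tendsto_average_boundedContinuousFunction`).

The degree tends to infinity by Northcott: in bounded degree and Mahler measure the house takes
finitely many values, so those exceeding 1 stay away from 1. Strictness holds because a proper
algebraic subgroup is finite, hence made of roots of unity. Finally, a bounded dynamical degree
would keep the house above some fixed `θ_n⁻¹ > 1`. -/

open ComplexConjugate in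
/-- The reflection of the exterior of the unit disc into the unit disc. -/
def discReflect (z : ℂ) : ℂ := if ‖z‖ ≤ 1 then z else (conj z)⁻¹

theorem norm_discReflect_le_one (z : ℂ) : ‖discReflect z‖ ≤ 1 := by
  unfold discReflect
  split_ifs with h
  · exact h
  · rw [norm_inv, RCLike.norm_conj]
    exact inv_le_one_of_one_le₀ (not_le.1 h).le

-- `‖1 - z w̄‖² - ‖z - w‖² = (1 - ‖z‖²)(1 - ‖w‖²)`.
open ComplexConjugate in
theorem norm_sub_le_norm_one_sub_mul_conj {z w : ℂ} (hz : ‖z‖ ≤ 1) (hw : ‖w‖ ≤ 1) :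
    ‖z - w‖ ≤ ‖1 - z * conj w‖ := by
  have hz2 : z.re * z.re + z.im * z.im ≤ 1 := by
    rw [← Complex.normSq_apply, Complex.normSq_eq_norm_sq]; nlinarith [norm_nonneg z]
  have hw2 : w.re * w.re + w.im * w.im ≤ 1 := by
    rw [← Complex.normSq_apply, Complex.normSq_eq_norm_sq]; nlinarith [norm_nonneg w]
  rw [← abs_of_nonneg (norm_nonneg (z - w)), ← abs_of_nonneg (norm_nonneg (1 - z * conj w)),
    ← sq_le_sq, ← Complex.normSq_eq_norm_sq, ← Complex.normSq_eq_norm_sq,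
    Complex.normSq_apply, Complex.normSq_apply]
  simp only [Complex.sub_re, Complex.sub_im, Complex.one_re, Complex.one_im, Complex.mul_re,
    Complex.mul_im, Complex.conj_re, Complex.conj_im]
  nlinarith [mul_nonneg (sub_nonneg.2 hz2) (sub_nonneg.2 hw2)]

/-- The difference of squares is `2(1-r)²(1 + Re z) + (1-r)(1+3r)(1 - ‖z‖²)`. Inserting `r < 1`
makes the logarithmic series converge and the diagonal terms finite; the cost `2/(1+r)` tends to 1
as `r → 1`. -/
theorem norm_one_sub_le_of_norm_le_one {z : ℂ} (hz : ‖z‖ ≤ 1) {r : ℝ} (hr0 : 0 ≤ r) (hr1 : r ≤ 1) :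
    ‖1 - z‖ ≤ 2 / (1 + r) * ‖1 - r * z‖ := by
  have hre : -1 ≤ z.re := by linarith [neg_abs_le z.re, Complex.abs_re_le_norm z]
  have hz2 : z.re * z.re + z.im * z.im ≤ 1 := by
    rw [← Complex.normSq_apply, Complex.normSq_eq_norm_sq]; nlinarith [norm_nonneg z]
  have key : ((1 + r) * ‖1 - z‖) ^ 2 ≤ (2 * ‖1 - r * z‖) ^ 2 := by
    rw [mul_pow, mul_pow, ← Complex.normSq_eq_norm_sq, ← Complex.normSq_eq_norm_sq,
      Complex.normSq_apply, Complex.normSq_apply]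
    simp only [Complex.sub_re, Complex.sub_im, Complex.one_re, Complex.one_im,
      Complex.re_ofReal_mul, Complex.im_ofReal_mul]
    have h1 := mul_nonneg (mul_nonneg (sub_nonneg.2 hr1) (sub_nonneg.2 hr1)) (sub_nonneg.2 hre)
    have h2 := mul_nonneg (mul_nonneg (sub_nonneg.2 hr1) (by linarith : 0 ≤ 1 + 3 * r))
      (sub_nonneg.2 hz2)
    nlinarith
  have := (sq_le_sq₀ (by positivity) (by positivity)).1 key
  rw [div_mul_eq_mul_div, le_div_iff₀ (by positivity)]
  linarith

-- A point `z` outside the disc is factored out, `z - w = z(1 - z⁻¹w)`, and `z⁻¹` is the conjugate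
-- of its reflection. If both points are outside, `z - w = zw(w⁻¹ - z⁻¹)` reduces to the disc.
open ComplexConjugate in
theorem norm_sub_le_max_mul_discReflect (z w : ℂ) :
    ‖z - w‖ ≤ max 1 ‖z‖ * max 1 ‖w‖ * ‖1 - discReflect z * conj (discReflect w)‖ := by
  have outer : ∀ {z w : ℂ}, ¬ ‖z‖ ≤ 1 → ‖w‖ ≤ 1 → ‖z - w‖ ≤ ‖z‖ * ‖1 - (conj z)⁻¹ * conj w‖ := by
    intro z w hz hw
    have hz0 : z ≠ 0 := fun h => hz (by simp [h])
    have : ‖1 - (conj z)⁻¹ * conj w‖ = ‖1 - z⁻¹ * w‖ := by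
      rw [← RCLike.norm_conj]; simp
    rw [this, ← norm_mul, mul_sub, mul_one, mul_inv_cancel_left₀ hz0]
  unfold discReflect
  split_ifs with hz hw hw
  · rw [max_eq_left hz, max_eq_left hw, one_mul, one_mul]
    exact norm_sub_le_norm_one_sub_mul_conj hz hw
  · have h := outer hw hz
    rw [norm_sub_rev, max_eq_left hz, max_eq_right (not_le.1 hw).le, one_mul]
    refine h.trans_eq ?_
    rw [← RCLike.norm_conj (1 - (conj w)⁻¹ * conj z)]
    simp [mul_comm]
  · rw [max_eq_right (not_le.1 hz).le, max_eq_left hw, mul_one]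
    exact outer hz hw
  · have hz0 : z ≠ 0 := fun h => hz (by simp [h])
    have hw0 : w ≠ 0 := fun h => hw (by simp [h])
    have hz1 := not_le.1 hz
    have hw1 := not_le.1 hw
    have h := norm_sub_le_norm_one_sub_mul_conj (z := (conj z)⁻¹) (w := (conj w)⁻¹)
      (by rw [norm_inv, RCLike.norm_conj]; exact inv_le_one_of_one_le₀ hz1.le)
      (by rw [norm_inv, RCLike.norm_conj]; exact inv_le_one_of_one_le₀ hw1.le)
    rw [max_eq_right hz1.le, max_eq_right hw1.le]
    have he : ‖z - w‖ = ‖z‖ * ‖w‖ * ‖(conj z)⁻¹ - (conj w)⁻¹‖ := by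
      rw [← RCLike.norm_conj ((conj z)⁻¹ - (conj w)⁻¹), ← norm_mul, ← norm_mul, norm_sub_rev]
      congr 1
      simp only [map_sub, map_inv₀, RCLike.conj_conj]
      field_simp
    rw [he]
    gcongr

open ComplexConjugate in
theorem norm_sub_le_energy_kernel (z w : ℂ) {r : ℝ} (hr0 : 0 ≤ r) (hr1 : r ≤ 1) :
    ‖z - w‖ ≤ max 1 ‖z‖ * max 1 ‖w‖ *
      (2 / (1 + r) * ‖1 - r * (discReflect z * conj (discReflect w))‖) := by
  refine (norm_sub_le_max_mul_discReflect z w).trans ?_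
  gcongr
  refine norm_one_sub_le_of_norm_le_one ?_ hr0 hr1
  rw [norm_mul, RCLike.norm_conj]
  exact mul_le_one₀ (norm_discReflect_le_one z) (norm_nonneg _) (norm_discReflect_le_one w)

open ComplexConjugate in
/-- Each power sum of points of the closed unit disc is controlled by a regularised logarithmic
energy. -/
theorem norm_sum_pow_sq_le_energy {ι : Type*} [Fintype ι] {z : ι → ℂ} (hz : ∀ i, ‖z i‖ ≤ 1)
    {r : ℝ} (hr0 : 0 ≤ r) (hr1 : r < 1) (k : ℕ) :
    r ^ k / k * ‖∑ i, z i ^ k‖ ^ 2 ≤ -∑ i, ∑ j, Real.log ‖1 - r * (z i * conj (z j))‖ := by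
  have hlt : ∀ i j, ‖(r : ℂ) * (z i * conj (z j))‖ < 1 := by
    intro i j
    rw [norm_mul, norm_mul, RCLike.norm_conj, Complex.norm_real, Real.norm_of_nonneg hr0]
    have := mul_le_one₀ (hz i) (norm_nonneg _) (hz j)
    nlinarith
  have hs : HasSum (fun n : ℕ => r ^ n / n * ‖∑ i, z i ^ n‖ ^ 2)
      (∑ i, ∑ j, -Real.log ‖1 - r * (z i * conj (z j))‖) := by
    have h := hasSum_sum (s := Finset.univ) fun i (_ : i ∈ Finset.univ) =>
      hasSum_sum (s := Finset.univ) fun j (_ : j ∈ Finset.univ) =>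
        Complex.hasSum_re (Complex.hasSum_taylorSeries_neg_log (hlt i j))
    simp only [Complex.neg_re, Complex.log_re] at h
    convert h using 2 with n
    simp only [← Complex.re_sum]
    -- The kernel is of positive type: the double sum of `n`-th powers factors as a squared modulus.
    have hsq : ∑ i, ∑ j, ((r : ℂ) * (z i * conj (z j))) ^ n / n =
        ((r ^ n / n * ‖∑ i, z i ^ n‖ ^ 2 : ℝ) : ℂ) := by
      push_cast
      rw [← Complex.mul_conj', map_sum, Finset.sum_mul_sum, Finset.mul_sum]
      refine Finset.sum_congr rfl fun i _ => ?_
      rw [Finset.mul_sum]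
      refine Finset.sum_congr rfl fun j _ => ?_
      rw [map_pow, mul_pow, mul_pow]
      ring
    rw [hsq, Complex.ofReal_re]
  simp only [Finset.sum_neg_distrib] at hs
  exact le_hasSum hs k fun n _ => by positivity

open ComplexConjugate in
theorem norm_sum_discReflect_pow_sq_le {ι : Type*} [Fintype ι] [DecidableEq ι] (x : ι → ℂ)
    (hdisc : 1 ≤ ∏ i, ∏ j ∈ {i}ᶜ, ‖x j - x i‖) {r : ℝ} (hr0 : 0 ≤ r) (hr1 : r < 1) (k : ℕ) :
    r ^ k / k * ‖∑ i, discReflect (x i) ^ k‖ ^ 2 ≤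
      2 * Fintype.card ι * ∑ i, Real.posLog ‖x i‖ +
        Fintype.card ι ^ 2 * Real.log (2 / (1 + r)) - Fintype.card ι * Real.log (1 - r) := by
  refine (norm_sum_pow_sq_le_energy (fun i => norm_discReflect_le_one (x i)) hr0 hr1 k).trans ?_
  set G : ι → ι → ℝ := fun i j => Real.log ‖1 - r * (discReflect (x i) * conj (discReflect (x j)))‖
    with hG
  set T : ι → ι → ℝ := fun i j =>
    Real.posLog ‖x i‖ + Real.posLog ‖x j‖ + (Real.log (2 / (1 + r)) + G i j) with hT
  have hpos : ∀ i j, 1 - r ≤ ‖1 - r * (discReflect (x i) * conj (discReflect (x j)))‖ := by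
    intro i j
    have h1 := norm_sub_norm_le (1 : ℂ) (r * (discReflect (x i) * conj (discReflect (x j))))
    rw [norm_one, norm_mul, norm_mul, RCLike.norm_conj, Complex.norm_real,
      Real.norm_of_nonneg hr0] at h1
    have := mul_le_one₀ (norm_discReflect_le_one (x i)) (norm_nonneg _)
      (norm_discReflect_le_one (x j))
    nlinarith
  have hpos' : ∀ i j, 0 < ‖1 - r * (discReflect (x i) * conj (discReflect (x j)))‖ :=
    fun i j => (sub_pos.2 hr1).trans_le (hpos i j)
  have hexp : ∀ i j, ‖x j - x i‖ ≤ Real.exp (T i j) := by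
    intro i j
    rw [norm_sub_rev]
    refine (norm_sub_le_energy_kernel (x i) (x j) hr0 hr1.le).trans_eq ?_
    simp only [hT, hG]
    rw [Real.exp_add, Real.exp_add, Real.exp_add, Real.exp_log (hpos' i j),
      Real.exp_log (by positivity), Real.posLog_eq_log_max_one (norm_nonneg _),
      Real.posLog_eq_log_max_one (norm_nonneg _), Real.exp_log (by positivity),
      Real.exp_log (by positivity)]
  -- The discriminant bound covers the off-diagonal pairs only; the diagonal is restored below at a
  -- cost of `log (1 - r)` per point.
  have hoff : 0 ≤ ∑ i, ∑ j ∈ {i}ᶜ, T i j := by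
    rw [← Real.one_le_exp_iff, Real.exp_sum]
    refine hdisc.trans ?_
    refine Finset.prod_le_prod (fun i _ => Finset.prod_nonneg fun j _ => norm_nonneg _) fun i _ => ?_
    rw [Real.exp_sum]
    exact Finset.prod_le_prod (fun j _ => norm_nonneg _) fun j _ => hexp i j
  have hdiag : ∀ i, Real.log (1 - r) ≤ T i i := by
    intro i
    have h1 : Real.log (1 - r) ≤ G i i := Real.log_le_log (sub_pos.2 hr1) (hpos i i)
    have h2 : 0 ≤ Real.log (2 / (1 + r)) :=
      Real.log_nonneg (by rw [le_div_iff₀ (by positivity)]; linarith)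
    have h3 := Real.posLog_nonneg (x := ‖x i‖)
    simp only [hT]
    linarith
  have hall : Fintype.card ι * Real.log (1 - r) ≤ ∑ i, ∑ j, T i j := by
    have h1 : ∑ i, ∑ j, T i j = ∑ i, T i i + ∑ i, ∑ j ∈ {i}ᶜ, T i j := by
      rw [← Finset.sum_add_distrib]
      refine Finset.sum_congr rfl fun i _ => ?_
      rw [← Finset.sum_add_sum_compl {i}, Finset.sum_singleton]
    have h2 : Fintype.card ι * Real.log (1 - r) ≤ ∑ i, T i i := by
      rw [← nsmul_eq_mul]
      exact Finset.card_nsmul_le_sum _ _ _ fun i _ => hdiag i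
    linarith
  have hsum : ∑ i, ∑ j, T i j = 2 * Fintype.card ι * ∑ i, Real.posLog ‖x i‖ +
      Fintype.card ι ^ 2 * Real.log (2 / (1 + r)) + ∑ i, ∑ j, G i j := by
    simp only [hT, Finset.sum_add_distrib, Finset.sum_const, Finset.card_univ, nsmul_eq_mul,
      ← Finset.mul_sum]
    ring
  linarith


/-! ### Equidistribution of finite families near the unit circle -/

/-- The average of a function over a finite type. -/
def average {ι : Type*} [Fintype ι] (g : ι → ℂ) : ℂ := (Fintype.card ι : ℂ)⁻¹ * ∑ i, g i

theorem average_sub {ι : Type*} [Fintype ι] (g h : ι → ℂ) :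
    average (fun i => g i - h i) = average g - average h := by
  simp only [average, Finset.sum_sub_distrib, mul_sub]

theorem norm_average_le {ι : Type*} [Fintype ι] {g : ι → ℂ} {b : ι → ℝ} (h : ∀ i, ‖g i‖ ≤ b i) :
    ‖average g‖ ≤ (Fintype.card ι : ℝ)⁻¹ * ∑ i, b i := by
  rw [average, norm_mul, norm_inv, Complex.norm_natCast]
  gcongr
  exact norm_sum_le_of_le _ fun i _ => h i

theorem norm_average_le_const {ι : Type*} [Fintype ι] {g : ι → ℂ} {C : ℝ} (hC : 0 ≤ C)
    (h : ∀ i, ‖g i‖ ≤ C) : ‖average g‖ ≤ C := by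
  refine (norm_average_le h).trans ?_
  rw [Finset.sum_const, Finset.card_univ, nsmul_eq_mul]
  rcases Nat.eq_zero_or_pos (Fintype.card ι) with h0 | h0
  · simp [h0, hC]
  · rw [inv_mul_cancel_left₀ (by positivity)]

/-- Translation by `1/(2n)` changes the sign of the character and preserves Haar measure. -/
theorem integral_fourier_of_ne_zero {n : ℤ} (hn : n ≠ 0) :
    ∫ t, fourier n t ∂(AddCircle.haarAddCircle (T := 1)) = 0 := by
  have h := integral_add_right_eq_self (μ := AddCircle.haarAddCircle (T := 1))
    (fun t => fourier n t) (((1 : ℝ) / 2 / n : ℝ) : AddCircle (1 : ℝ))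
  simp_rw [fourier_add_half_inv_index hn one_pos] at h
  rw [integral_neg] at h
  linear_combination (-1 / 2 : ℂ) * h

/-- Weyl's criterion for families of finite subsets of the circle. -/
theorem tendsto_average_addCircle {ι : ℕ → Type*} [∀ q, Fintype (ι q)]
    (hcard : Tendsto (fun q => Fintype.card (ι q)) atTop atTop)
    (t : ∀ q, ι q → AddCircle (1 : ℝ))
    (hpow : ∀ k : ℕ, 0 < k →
      Tendsto (fun q => average fun i => fourier (k : ℤ) (t q i)) atTop (𝓝 0))
    (g : C(AddCircle (1 : ℝ), ℂ)) :
    Tendsto (fun q => average fun i => g (t q i)) atTop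
      (𝓝 (∫ s, g s ∂AddCircle.haarAddCircle)) := by
  have hint : ∀ g : C(AddCircle (1 : ℝ), ℂ), Integrable g AddCircle.haarAddCircle := fun g =>
    g.continuous.integrable_of_hasCompactSupport (HasCompactSupport.of_compactSpace _)
  have hfourier : ∀ n : ℤ, Tendsto (fun q => average fun i => fourier n (t q i)) atTop
      (𝓝 (∫ s, fourier n s ∂AddCircle.haarAddCircle (T := 1))) := by
    intro n
    rcases lt_trichotomy n 0 with hn | rfl | hn
    · rw [integral_fourier_of_ne_zero hn.ne]
      have h := (hpow (-n).toNat (by omega)).star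
      rw [Int.toNat_of_nonneg (by omega), star_zero] at h
      refine h.congr fun q => ?_
      simp [average]
    · simp only [fourier_zero, integral_const, probReal_univ, one_smul]
      -- The average of 1 is 1 only over a nonempty index type, hence only eventually.
      refine tendsto_const_nhds.congr' ?_
      filter_upwards [hcard.eventually_gt_atTop 0] with q hq
      have : (Fintype.card (ι q) : ℂ) ≠ 0 := by exact_mod_cast hq.ne'
      simp [average, this]
    · rw [integral_fourier_of_ne_zero hn.ne']
      have h := hpow n.toNat (by omega)
      rwa [Int.toNat_of_nonneg hn.le] at h
  have hspan : ∀ g ∈ Submodule.span ℂ (Set.range (fourier (T := 1))),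
      Tendsto (fun q => average fun i => g (t q i)) atTop
        (𝓝 (∫ s, g s ∂AddCircle.haarAddCircle)) := by
    intro g hg
    induction hg using Submodule.span_induction with
    | mem g hg => obtain ⟨n, rfl⟩ := hg; exact hfourier n
    | zero => simp [average]
    | add g h _ _ hg hh =>
      simp only [ContinuousMap.add_apply]
      rw [integral_add (hint g) (hint h)]
      refine (hg.add hh).congr fun q => ?_
      simp only [average, Finset.sum_add_distrib, mul_add]
    | smul c g _ hg =>
      simp only [ContinuousMap.smul_apply]
      rw [integral_smul]
      refine (hg.const_smul c).congr fun q => ?_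
      simp only [average, smul_eq_mul, ← Finset.mul_sum]
      ring
  have hdense : g ∈ closure (Submodule.span ℂ (Set.range (fourier (T := 1))) : Set _) := by
    rw [← Submodule.topologicalClosure_coe, span_fourier_closure_eq_top]
    trivial
  rw [Metric.tendsto_atTop]
  intro ε hε
  obtain ⟨h, hh, hgh⟩ := Metric.mem_closure_iff.1 hdense (ε / 3) (by positivity)
  rw [dist_eq_norm] at hgh
  obtain ⟨N, hN⟩ := Metric.tendsto_atTop.1 (hspan h hh) (ε / 3) (by positivity)
  refine ⟨N, fun q hq => ?_⟩
  have h1 : dist (average fun i => g (t q i)) (average fun i => h (t q i)) ≤ ‖g - h‖ := by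
    rw [dist_eq_norm, ← average_sub]
    exact norm_average_le_const (norm_nonneg _) fun i => (g - h).norm_coe_le_norm (t q i)
  have h2 : dist (∫ s, h s ∂AddCircle.haarAddCircle) (∫ s, g s ∂AddCircle.haarAddCircle) ≤
      ‖g - h‖ := by
    rw [dist_comm, dist_eq_norm, ← integral_sub (hint g) (hint h)]
    refine (norm_integral_le_of_norm_le_const (C := ‖g - h‖)
      (Eventually.of_forall fun s => (g - h).norm_coe_le_norm s)).trans ?_
    simp
  have h3 := hN q hq
  have h4 := dist_triangle4 (average fun i => g (t q i)) (average fun i => h (t q i))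
    (∫ s, h s ∂AddCircle.haarAddCircle) (∫ s, g s ∂AddCircle.haarAddCircle)
  linarith

/-- Polar coordinates on `ℂˣ`. -/
def polar (s : ℝ) (t : AddCircle (1 : ℝ)) : ℂˣ :=
  Units.mk0 (Real.exp s : ℂ) (by exact_mod_cast (Real.exp_pos s).ne') *
    Circle.toUnits (AddCircle.toCircle t)

@[simp] theorem coe_polar (s : ℝ) (t : AddCircle (1 : ℝ)) :
    (polar s t : ℂ) = Real.exp s * (AddCircle.toCircle t : ℂ) := rfl

theorem continuous_polar : Continuous fun p : ℝ × AddCircle (1 : ℝ) => polar p.1 p.2 := by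
  rw [Units.isEmbedding_val₀.continuous_iff]
  have : Continuous fun t : AddCircle (1 : ℝ) => ((AddCircle.toCircle t : Circle) : ℂ) :=
    continuous_subtype_val.comp AddCircle.continuous_toCircle
  change Continuous fun p : ℝ × AddCircle (1 : ℝ) =>
    (Real.exp p.1 : ℂ) * (AddCircle.toCircle p.2 : ℂ)
  fun_prop

theorem exists_polar_eq (z : ℂˣ) : ∃ t, polar (Real.log ‖(z : ℂ)‖) t = z := by
  have hz : 0 < ‖(z : ℂ)‖ := norm_pos_iff.2 z.ne_zero
  have hu : (z : ℂ) / ‖(z : ℂ)‖ ∈ Submonoid.unitSphere ℂ := by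
    rw [← SetLike.mem_coe, Submonoid.coe_unitSphere, mem_sphere_zero_iff_norm, norm_div, Complex.norm_real, norm_norm, div_self hz.ne']
  obtain ⟨t, ht⟩ := (AddCircle.homeomorphCircle (one_ne_zero (α := ℝ))).surjective ⟨_, hu⟩
  refine ⟨t, Units.ext ?_⟩
  rw [AddCircle.homeomorphCircle_apply] at ht
  rw [coe_polar, ht, Real.exp_log hz]
  have : (‖(z : ℂ)‖ : ℂ) ≠ 0 := by exact_mod_cast hz.ne'
  exact mul_div_cancel₀ _ this

open ComplexConjugate in
theorem discReflect_polar (s : ℝ) (t : AddCircle (1 : ℝ)) :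
    discReflect (polar s t) = Real.exp (-|s|) * (AddCircle.toCircle t : ℂ) := by
  have hn : ‖(polar s t : ℂ)‖ = Real.exp s := by
    rw [coe_polar, norm_mul, Circle.norm_coe, mul_one, Complex.norm_real,
      Real.norm_of_nonneg (Real.exp_pos s).le]
  unfold discReflect
  simp only [hn, Real.exp_le_one_iff]
  split_ifs with hs
  · rw [abs_of_nonpos hs, neg_neg, coe_polar]
  · rw [abs_of_pos (not_le.1 hs), coe_polar, map_mul, Complex.conj_ofReal,
      ← Circle.coe_inv_eq_conj, mul_inv, ← Circle.coe_inv, inv_inv, Real.exp_neg,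
      Complex.ofReal_inv]

/-- The two differ by the radial factor `e^{-k|s|}` alone, and `0 ≤ 1 - e^{-u} ≤ u` for `u ≥ 0`. -/
theorem norm_fourier_sub_discReflect_pow_le (s : ℝ) (t : AddCircle (1 : ℝ)) (k : ℕ) :
    ‖fourier (k : ℤ) t - discReflect (polar s t) ^ k‖ ≤ k * |s| := by
  have h : fourier (k : ℤ) t - discReflect (polar s t) ^ k =
      ((1 - Real.exp (-(k * |s|)) : ℝ) : ℂ) * (AddCircle.toCircle t : ℂ) ^ k := by
    rw [fourier_apply, natCast_zsmul, AddCircle.toCircle_nsmul, discReflect_polar, mul_pow,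
      ← Complex.ofReal_pow, ← Real.exp_nat_mul, Circle.coe_pow, mul_neg]
    push_cast
    ring
  rw [h, norm_mul, norm_pow, Circle.norm_coe, one_pow, mul_one, Complex.norm_real, Real.norm_eq_abs,
    abs_le]
  have h1 := Real.add_one_le_exp (-(k * |s|))
  have h2 : Real.exp (-(k * |s|)) ≤ 1 := Real.exp_le_one_iff.2 (by simp; positivity)
  constructor <;> nlinarith [abs_nonneg s, (Nat.cast_nonneg k : (0 : ℝ) ≤ k)]

/-- `|log y| = 2 log⁺ y - log y`, and the logarithms have nonnegative sum. -/
theorem sum_abs_log_le {ι : Type*} [Fintype ι] {y : ι → ℝ} (hprod : 1 ≤ ∏ i, |y i|) :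
    ∑ i, |Real.log (y i)| ≤ 2 * ∑ i, Real.posLog (y i) := by
  have h0 : ∀ i, y i ≠ 0 := by
    intro i hi
    rw [Finset.prod_eq_zero (Finset.mem_univ i) (by simp [hi])] at hprod
    linarith
  have h1 : 0 ≤ ∑ i, Real.log (y i) := by
    have := Real.log_nonneg hprod
    rw [Real.log_prod fun i _ => abs_ne_zero.2 (h0 i)] at this
    simpa only [Real.log_abs] using this
  have h2 : ∀ i, |Real.log (y i)| = 2 * Real.posLog (y i) - Real.log (y i) := by
    intro i
    rw [← Real.half_mul_log_add_log_abs]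
    ring
  simp only [h2, Finset.sum_sub_distrib, ← Finset.mul_sum]
  linarith

/-- This is the energy bound at `r = 1 - 1/d`, divided by `d²`. That `r` tends to 1, killing `log
(2/(1+r))`, yet slowly enough that the diagonal contributes only `log d / d`. -/
theorem tendsto_energy_bound (B : ℝ) (k : ℕ) :
    Tendsto (fun d : ℕ => ((1 - (d : ℝ)⁻¹) ^ k)⁻¹ *
      (2 * B * (d : ℝ)⁻¹ + Real.log (2 / (1 + (1 - (d : ℝ)⁻¹))) + Real.log d / d))
      atTop (𝓝 0) := by
  have hi : Tendsto (fun d : ℕ => (d : ℝ)⁻¹) atTop (𝓝 0) := tendsto_inv_atTop_nhds_zero_nat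
  have h1 : Tendsto (fun d : ℕ => 1 - (d : ℝ)⁻¹) atTop (𝓝 1) := by simpa using hi.const_sub 1
  have h2 : Tendsto (fun d : ℕ => ((1 - (d : ℝ)⁻¹) ^ k)⁻¹) atTop (𝓝 1) := by
    simpa using (h1.pow k).inv₀ (by simp)
  have h3 : Tendsto (fun d : ℕ => Real.log (2 / (1 + (1 - (d : ℝ)⁻¹)))) atTop (𝓝 0) := by
    have h4 : Tendsto (fun d : ℕ => 2 / (1 + (1 - (d : ℝ)⁻¹))) atTop (𝓝 1) := by
      have := (tendsto_const_nhds (x := (2 : ℝ))).div (h1.const_add 1) (by norm_num)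
      norm_num at this
      exact this
    simpa using h4.log one_ne_zero
  have h5 : Tendsto (fun d : ℕ => Real.log d / d) atTop (𝓝 0) :=
    (Real.isLittleO_log_id_atTop.tendsto_div_nhds_zero).comp tendsto_natCast_atTop_atTop
  simpa using h2.mul (((hi.const_mul (2 * B)).add h3).add h5)

theorem tendsto_average_discReflect_pow {ι : ℕ → Type*} [∀ q, Fintype (ι q)]
    [∀ q, DecidableEq (ι q)] (hcard : Tendsto (fun q => Fintype.card (ι q)) atTop atTop)
    (x : ∀ q, ι q → ℂ) (B : ℝ) (hB : ∀ q, ∑ i, Real.posLog ‖x q i‖ ≤ B)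
    (hdisc : ∀ q, 1 ≤ ∏ i, ∏ j ∈ {i}ᶜ, ‖x q j - x q i‖) {k : ℕ} (hk : 0 < k) :
    Tendsto (fun q => average fun i => discReflect (x q i) ^ k) atTop (𝓝 0) := by
  rw [tendsto_zero_iff_norm_tendsto_zero]
  have hlim := ((tendsto_energy_bound B k).comp hcard).const_mul (k : ℝ)
  rw [mul_zero] at hlim
  have hsq : Tendsto (fun q => ‖average fun i => discReflect (x q i) ^ k‖ ^ 2) atTop (𝓝 0) := by
    refine squeeze_zero' (Eventually.of_forall fun q => by positivity) ?_ hlim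
    filter_upwards [hcard.eventually_gt_atTop 1] with q hq
    have hd : (1 : ℝ) < Fintype.card (ι q) := by exact_mod_cast hq
    have hd0 : (0 : ℝ) < Fintype.card (ι q) := by linarith
    have hr : 0 < 1 - (Fintype.card (ι q) : ℝ)⁻¹ := sub_pos.2 (inv_lt_one_of_one_lt₀ hd)
    have h := norm_sum_discReflect_pow_sq_le (x q) (hdisc q) hr.le
      (sub_lt_self _ (inv_pos.2 hd0)) k
    rw [sub_sub_cancel, Real.log_inv] at h
    simp only [Function.comp_apply, average, norm_mul, norm_inv, Complex.norm_natCast]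
    have hk' : (0 : ℝ) < k := by exact_mod_cast hk
    have hB' := mul_le_mul_of_nonneg_left (hB q) (by positivity :
      (0 : ℝ) ≤ 2 * Fintype.card (ι q))
    set d : ℝ := (Fintype.card (ι q) : ℝ)
    set N := ‖∑ i, discReflect (x q i) ^ k‖
    set ℓ := Real.log (2 / (1 + (1 - d⁻¹)))
    set R := (1 - d⁻¹) ^ k with hR
    have hR0 : 0 < R := pow_pos hr k
    have h1 : R / k * N ^ 2 ≤ d ^ 2 * (2 * B * d⁻¹ + ℓ + Real.log d / d) := by
      refine h.trans ?_
      have : d ^ 2 * (2 * B * d⁻¹ + ℓ + Real.log d / d) = 2 * d * B + d ^ 2 * ℓ + d * Real.log d := by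
        field_simp
      rw [this]
      linarith
    calc (d⁻¹ * N) ^ 2 = k * (R⁻¹ * ((d ^ 2)⁻¹ * (R / k * N ^ 2))) := by field_simp
      _ ≤ k * (R⁻¹ * ((d ^ 2)⁻¹ * (d ^ 2 * (2 * B * d⁻¹ + ℓ + Real.log d / d)))) := by gcongr
      _ = _ := by rw [inv_mul_cancel_left₀ (by positivity)]
  have := hsq.sqrt
  simpa [Real.sqrt_sq] using this

/-- Families of nonzero complex numbers of growing size, of bounded Mahler measure, whose product
and discriminant are at least `1` in modulus become equidistributed on the unit circle. -/
theorem tendsto_average_boundedContinuousFunction {ι : ℕ → Type*} [∀ q, Fintype (ι q)]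
    [∀ q, DecidableEq (ι q)] (hcard : Tendsto (fun q => Fintype.card (ι q)) atTop atTop)
    (x : ∀ q, ι q → ℂˣ) (B : ℝ) (hB : ∀ q, ∑ i, Real.posLog ‖(x q i : ℂ)‖ ≤ B)
    (hprod : ∀ q, 1 ≤ ∏ i, ‖(x q i : ℂ)‖)
    (hdisc : ∀ q, 1 ≤ ∏ i, ∏ j ∈ {i}ᶜ, ‖(x q j : ℂ) - x q i‖) (f : ℂˣ →ᵇ ℂ) :
    Tendsto (fun q => average fun i => f (x q i)) atTop (𝓝 (∫ z, f z ∂haarCircle)) := by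
  choose t ht using fun q i => exists_polar_eq (x q i)
  have hlog : ∀ q, ∑ i, |Real.log ‖(x q i : ℂ)‖| ≤ 2 * B := by
    intro q
    have h := sum_abs_log_le (y := fun i => ‖(x q i : ℂ)‖) (by simpa using hprod q)
    linarith [hB q]
  have hradial : ∀ c : ℝ, Tendsto (fun q => (Fintype.card (ι q) : ℝ)⁻¹ * (c * (2 * B)))
      atTop (𝓝 0) := by
    intro c
    simpa using ((tendsto_inv_atTop_nhds_zero_nat (𝕜 := ℝ)).comp hcard).mul_const (c * (2 * B))
  have hpow : ∀ k : ℕ, 0 < k →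
      Tendsto (fun q => average fun i => fourier (k : ℤ) (t q i)) atTop (𝓝 0) := by
    intro k hk
    have h1 := tendsto_average_discReflect_pow hcard (fun q i => (x q i : ℂ)) B hB hdisc hk
    have h2 : Tendsto (fun q => (average fun i => fourier (k : ℤ) (t q i)) -
        average fun i => discReflect (x q i) ^ k) atTop (𝓝 0) := by
      refine squeeze_zero_norm (fun q => ?_) (hradial k)
      rw [← average_sub]
      refine (norm_average_le (b := fun i => k * |Real.log ‖(x q i : ℂ)‖|) fun i => ?_).trans ?_
      · conv_lhs => rw [← ht q i]
        exact norm_fourier_sub_discReflect_pow_le _ _ _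
      · rw [← Finset.mul_sum]
        gcongr
        exact hlog q
    simpa using h2.add h1
  -- Currying into the sup norm makes continuity at radius 1 uniform in the angle.
  let F : C(ℝ, C(AddCircle (1 : ℝ), ℂ)) :=
    ContinuousMap.curry ⟨fun p => f (polar p.1 p.2), f.continuous.comp continuous_polar⟩
  have hF : ∀ s t, F s t = f (polar s t) := fun _ _ => rfl
  have hcircle : Tendsto (fun q => average fun i => F 0 (t q i)) atTop
      (𝓝 (∫ z, f z ∂haarCircle)) := by
    have hpolar : ∀ t : AddCircle (1 : ℝ), Circle.toUnits (AddCircle.toCircle t) = polar 0 t := by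
      intro t
      ext
      simp
    have : ∫ z, f z ∂haarCircle = ∫ s, F 0 s ∂AddCircle.haarAddCircle := by
      simp only [haarCircle, hpolar, hF]
      rw [integral_map]
      · exact (continuous_polar.comp (by fun_prop :
          Continuous fun t : AddCircle (1 : ℝ) => ((0 : ℝ), t))).aemeasurable
      · exact f.continuous.aestronglyMeasurable
    rw [this]
    exact tendsto_average_addCircle hcard t hpow (F 0)
  have hdiff : Tendsto (fun q => (average fun i => f (x q i)) - average fun i => F 0 (t q i))
      atTop (𝓝 0) := by
    rw [Metric.tendsto_atTop]
    intro ε hε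
    obtain ⟨δ, hδ, hδF⟩ := Metric.continuousAt_iff.1 (F.continuous.continuousAt (x := 0)) (ε / 2) (half_pos hε)
    obtain ⟨N, hN⟩ := Metric.tendsto_atTop.1
      ((hradial (2 * ‖f‖ / δ)).comp (tendsto_id (α := ℕ))) (ε / 2) (half_pos hε)
    obtain ⟨N', hN'⟩ := eventually_atTop.1 (hcard.eventually_gt_atTop 0)
    refine ⟨max N N', fun q hq => ?_⟩
    -- A Chebyshev argument: uniform continuity when `|s| < δ`, otherwise the trivial bound `2‖f‖`
    -- multiplied by `|s|/δ ≥ 1`.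
    have hbound : ∀ i, ‖f (x q i) - F 0 (t q i)‖ ≤
        ε / 2 + 2 * ‖f‖ / δ * |Real.log ‖(x q i : ℂ)‖| := by
      intro i
      conv_lhs => rw [← ht q i]
      rw [← hF]
      set s := Real.log ‖(x q i : ℂ)‖
      rcases lt_or_ge |s| δ with hs | hs
      · have h1 := hδF (x := s) (by simpa using hs)
        rw [dist_eq_norm] at h1
        have h2 := (F s - F 0).norm_coe_le_norm (t q i)
        have : 0 ≤ 2 * ‖f‖ / δ * |s| := by positivity
        rw [ContinuousMap.sub_apply] at h2
        linarith
      · have h1 := norm_sub_le (F s (t q i)) (F 0 (t q i))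
        have h2 : ‖F s (t q i)‖ ≤ ‖f‖ := f.norm_coe_le_norm _
        have h3 : ‖F 0 (t q i)‖ ≤ ‖f‖ := f.norm_coe_le_norm _
        have h4 : 2 * ‖f‖ ≤ 2 * ‖f‖ / δ * |s| := by
          rw [div_mul_eq_mul_div, le_div_iff₀ hδ]
          gcongr
        linarith
    have hd : (0 : ℝ) < Fintype.card (ι q) := by
      exact_mod_cast hN' q (le_trans (le_max_right _ _) hq)
    rw [dist_zero_right, ← average_sub]
    refine (norm_average_le hbound).trans_lt ?_
    have h1 := hN q (le_trans (le_max_left _ _) hq)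
    rw [dist_zero_right, Real.norm_eq_abs] at h1
    have h2 := (le_abs_self _).trans_lt h1
    rw [Finset.sum_add_distrib, Finset.sum_const, Finset.card_univ, nsmul_eq_mul, mul_add,
      inv_mul_cancel_left₀ hd.ne', ← Finset.mul_sum]
    have h3 : (Fintype.card (ι q) : ℝ)⁻¹ * (2 * ‖f‖ / δ * ∑ i, |Real.log ‖(x q i : ℂ)‖|) ≤
        (Fintype.card (ι q) : ℝ)⁻¹ * (2 * ‖f‖ / δ * (2 * B)) := by
      gcongr
      exact hlog q
    simp only [Function.comp_apply, id_eq] at h2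
    linarith
  simpa using hdiff.add hcircle


/-! ### The conjugates of an algebraic integer -/

theorem one_le_abs_of_isIntegral {c : ℚ} (hc : IsIntegral ℤ c) (h0 : c ≠ 0) : 1 ≤ |c| := by
  obtain ⟨n, rfl⟩ := IsIntegrallyClosed.isIntegral_iff.1 hc
  have hn : n ≠ 0 := fun h => h0 (by simp [h])
  simpa using (by exact_mod_cast Int.one_le_abs hn : (1 : ℚ) ≤ |(n : ℚ)|)

theorem one_le_norm_of_isIntegral {c : ℚ} (hc : IsIntegral ℤ c) (h0 : c ≠ 0) :
    1 ≤ ‖algebraMap ℚ ℂ c‖ := by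
  have := one_le_abs_of_isIntegral hc h0
  rw [eq_ratCast, Complex.norm_ratCast]
  exact_mod_cast this

theorem isIntegral_gen {z : ℂ} (hz : IsIntegral ℤ z) : IsIntegral ℤ (AdjoinSimple.gen ℚ z) :=
  (isIntegral_algebraMap_iff (algebraMap ℚ⟮z⟯ ℂ).injective).1
    (by rwa [AdjoinSimple.algebraMap_gen])

theorem finiteDimensional_adjoin {z : ℂ} (hz : IsIntegral ℤ z) : FiniteDimensional ℚ ℚ⟮z⟯ :=
  adjoin.finiteDimensional hz.tower_top

/-- The product is the modulus of the norm, a nonzero rational integer. -/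
theorem one_le_prod_norm_embeddings {z : ℂ} (hz : IsIntegral ℤ z) (h0 : z ≠ 0)
    [Fintype (ℚ⟮z⟯ →ₐ[ℚ] ℂ)] :
    1 ≤ ∏ σ : ℚ⟮z⟯ →ₐ[ℚ] ℂ, ‖σ (AdjoinSimple.gen ℚ z)‖ := by
  have := finiteDimensional_adjoin hz
  have hg0 : AdjoinSimple.gen ℚ z ≠ 0 := by
    intro h
    exact h0 (by rw [← AdjoinSimple.coe_gen ℚ z, h]; rfl)
  have h := one_le_norm_of_isIntegral (Algebra.isIntegral_norm ℚ (isIntegral_gen hz))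
    (Algebra.norm_ne_zero_iff.2 hg0)
  rw [Algebra.norm_eq_prod_embeddings ℚ ℂ, norm_prod] at h
  convert h

/-- The discriminant of the power basis of an algebraic integer is at least `1` in modulus. -/
theorem one_le_prod_norm_sub_of_powerBasis {L : Type*} [Field L] [Algebra ℚ L]
    (pb : PowerBasis ℚ L) (hpb : IsIntegral ℤ pb.gen)
    [hF : Fintype (L →ₐ[ℚ] ℂ)] [hD : DecidableEq (L →ₐ[ℚ] ℂ)] :
    1 ≤ ∏ σ : L →ₐ[ℚ] ℂ, ∏ τ ∈ {σ}ᶜ, ‖τ pb.gen - σ pb.gen‖ := by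
  have := pb.finite
  have e : Fin pb.dim ≃ (L →ₐ[ℚ] ℂ) := by
    refine Fintype.equivOfCardEq ?_
    rw [Fintype.card_fin, ← PowerBasis.finrank pb]
    refine (AlgHom.card ℚ L ℂ).symm.trans ?_
    convert rfl
  have hint : IsIntegral ℤ (Algebra.discr ℚ pb.basis) := by
    refine Algebra.discr_isIntegral (K := ℚ) fun i => ?_
    rw [pb.basis_eq_pow]
    exact hpb.pow _
  have h := one_le_norm_of_isIntegral hint (Algebra.discr_not_zero_of_basis ℚ pb.basis)
  rw [Algebra.discr_powerBasis_eq_prod'' ℚ ℂ pb e, Finset.prod_prod_Ioi_mul_eq_prod_prod_off_diag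
    (fun i j => e i pb.gen - e j pb.gen), norm_mul, norm_pow,
    norm_neg, norm_one, one_pow, one_mul, norm_prod] at h
  refine h.trans_eq ?_
  rw [← Equiv.prod_comp e]
  refine Finset.prod_congr rfl fun i _ => ?_
  rw [norm_prod]
  exact Finset.prod_equiv e (by simp) fun j _ => rfl

theorem one_le_prod_norm_sub_embeddings {z : ℂ} (hz : IsIntegral ℤ z)
    [hF : Fintype (ℚ⟮z⟯ →ₐ[ℚ] ℂ)] [hD : DecidableEq (ℚ⟮z⟯ →ₐ[ℚ] ℂ)] :
    1 ≤ ∏ σ : ℚ⟮z⟯ →ₐ[ℚ] ℂ, ∏ τ ∈ {σ}ᶜ,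
      ‖τ (AdjoinSimple.gen ℚ z) - σ (AdjoinSimple.gen ℚ z)‖ :=
  one_le_prod_norm_sub_of_powerBasis (adjoin.powerBasis (K := ℚ) hz.tower_top) (isIntegral_gen hz)
    (hF := hF) (hD := hD)

theorem card_embeddings {z : ℂ} (hz : IsIntegral ℤ z) [Fintype (ℚ⟮z⟯ →ₐ[ℚ] ℂ)] :
    Fintype.card (ℚ⟮z⟯ →ₐ[ℚ] ℂ) = (minpoly ℚ z).natDegree :=
  Nat.card_eq_fintype_card.symm.trans (card_algHom_adjoin_integral ℚ hz.tower_top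
    (minpoly.irreducible hz.tower_top).separable (IsAlgClosed.splits _))

theorem minpoly_int_map_complex {z : ℂ} (hz : IsIntegral ℤ z) :
    (minpoly ℤ z).map (Int.castRingHom ℂ) = (minpoly ℚ z).map (algebraMap ℚ ℂ) := by
  rw [minpoly.isIntegrallyClosed_eq_field_fractions' ℚ hz, Polynomial.map_map]
  congr 1

theorem mahler_eq_prod_embeddings {z : ℂ} (hz : IsIntegral ℤ z) [Fintype (ℚ⟮z⟯ →ₐ[ℚ] ℂ)] :
    mahler z = ∏ σ : ℚ⟮z⟯ →ₐ[ℚ] ℂ, max 1 ‖σ (AdjoinSimple.gen ℚ z)‖ := by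
  have hzQ : IsIntegral ℚ z := hz.tower_top
  rw [mahler, mahlerMeasure_eq_leadingCoeff_mul_prod_roots, minpoly_int_map_complex hz,
    ((minpoly.monic hzQ).map _).leadingCoeff, norm_one, one_mul]
  have hnodup : ((minpoly ℚ z).map (algebraMap ℚ ℂ)).roots.Nodup :=
    nodup_roots (minpoly.irreducible hzQ).separable.map
  rw [← Finset.prod_mk _ hnodup]
  symm
  refine Finset.prod_bij (fun σ _ => σ (AdjoinSimple.gen ℚ z)) (fun σ _ => ?_) (fun σ _ τ _ h => ?_)
    (fun w hw => ?_) fun _ _ => rfl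
  · rw [Finset.mem_mk]
    exact (algHomAdjoinIntegralEquiv ℚ (K := ℂ) hzQ σ).2
  · exact (adjoin.powerBasis hzQ).algHom_ext h
  · refine ⟨(algHomAdjoinIntegralEquiv ℚ hzQ).symm ⟨w, hw⟩, Finset.mem_univ _, ?_⟩
    exact algHomAdjoinIntegralEquiv_symm_apply_gen ℚ hzQ ⟨w, hw⟩

theorem sum_posLog_embeddings_le_mahler {z : ℂ} (hz : IsIntegral ℤ z)
    [Fintype (ℚ⟮z⟯ →ₐ[ℚ] ℂ)] :
    ∑ σ : ℚ⟮z⟯ →ₐ[ℚ] ℂ, Real.posLog ‖σ (AdjoinSimple.gen ℚ z)‖ ≤ mahler z := by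
  simp only [Real.posLog_eq_log_max_one (norm_nonneg _)]
  rw [← Real.log_prod fun σ _ => by positivity, ← mahler_eq_prod_embeddings hz]
  exact Real.log_le_self (mahlerMeasure_nonneg _)

theorem natDegree_minpoly_int {z : ℂ} (hz : IsIntegral ℤ z) :
    (minpoly ℤ z).natDegree = (minpoly ℚ z).natDegree := by
  rw [minpoly.isIntegrallyClosed_eq_field_fractions' ℚ hz, (minpoly.monic hz).natDegree_map]

theorem one_lt_house {z : ℂ} (hz : IsIntegral ℤ z) (h : 1 < ‖z‖) : 1 < house z := by
  have hmem : z ∈ (minpoly ℚ z).rootSet ℂ := by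
    rw [mem_rootSet]
    exact ⟨minpoly.ne_zero hz.tower_top, minpoly.aeval ℚ z⟩
  exact h.trans_le (le_ciSup (f := fun w : (minpoly ℚ z).rootSet ℂ => ‖(w : ℂ)‖)
    (Set.finite_range _).bddAbove ⟨z, hmem⟩)

/-- Algebraic integers outside the closed unit disc, of bounded Mahler measure and of house tending
to `1`, have degree tending to infinity. -/
theorem tendsto_natDegree_minpoly {z : ℕ → ℂ} (hz : ∀ q, IsIntegral ℤ (z q))
    (habs : ∀ q, 1 < ‖z q‖) {B : ℝ} (hB : ∀ q, mahler (z q) ≤ B)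
    (hhouse : Tendsto (fun q => house (z q)) atTop (𝓝 1)) :
    Tendsto (fun q => (minpoly ℚ (z q)).natDegree) atTop atTop := by
  refine tendsto_atTop.2 fun D => ?_
  have hfin := Polynomial.finite_mahlerMeasure_le D B.toNNReal
  -- The house depends only on the integral minimal polynomial, which ranges over the finite
  -- Northcott set if the degree is bounded.
  let H : ℤ[X] → ℝ := fun p =>
    ⨆ w : (p.map (Int.castRingHom ℚ)).rootSet ℂ, ‖(w : ℂ)‖
  have hH : ∀ q, house (z q) = H (minpoly ℤ (z q)) := by
    intro q
    simp only [house, H]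
    rw [minpoly.isIntegrallyClosed_eq_field_fractions' ℚ (hz q)]
    rfl
  have hev : ∀ᶠ q in atTop, ∀ p ∈ {p : ℤ[X] | p.natDegree ≤ D ∧
      (p.map (Int.castRingHom ℂ)).mahlerMeasure ≤ B.toNNReal}, 1 < H p → house (z q) < H p := by
    rw [hfin.eventually_all]
    intro p _
    by_cases hp : 1 < H p
    · filter_upwards [hhouse.eventually_lt_const hp] with q hq _ using hq
    · exact Eventually.of_forall fun q h => absurd h hp
  filter_upwards [hev] with q hq
  by_contra! hlt
  refine lt_irrefl (house (z q)) ?_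
  have h1 := one_lt_house (hz q) (habs q)
  nth_rewrite 2 [hH q]
  refine hq _ ⟨?_, (hB q).trans (Real.le_coe_toNNReal B)⟩ (by rwa [← hH q])
  rw [natDegree_minpoly_int (hz q)]
  exact hlt.le

theorem integral_galoisMeasure (a : QBarˣ) (ha : IsIntegral ℤ ((a : QBar) : ℂ))
    [Fintype (ℚ⟮((a : QBar) : ℂ)⟯ →ₐ[ℚ] ℂ)] (f : ℂˣ →ᵇ ℂ) :
    ∫ z, f z ∂(galoisMeasure a) = average fun σ => f (conj a σ) := by
  rw [galoisMeasure, integral_smul_measure, Measure.sum_fintype, integral_finsetSum_measure]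
  · simp only [integral_dirac' _ _ f.continuous.stronglyMeasurable, average]
    rw [card_embeddings ha]
    simp
  · intro σ _
    exact integrable_dirac' f.continuous.stronglyMeasurable (by simp)

/-! ### Algebraic subgroups, dynamical degrees and Galois orbits -/

/-- Some nonzero polynomial vanishes on `H`, so `H` is finite and its elements are roots of unity.
-/
theorem norm_eq_one_of_mem_isAlgebraicSubgroup {H : Subgroup QBarˣ} (hH : IsAlgebraicSubgroup H)
    (htop : H ≠ ⊤) {x : QBarˣ} (hx : x ∈ H) : ‖((x : QBar) : ℂ)‖ = 1 := by
  obtain ⟨S, hS⟩ := hH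
  obtain ⟨p, hpS, hp⟩ : ∃ p ∈ S, p ≠ 0 := by
    by_contra! h
    refine htop (Subgroup.eq_top_iff' H |>.2 fun y => (hS y).2 fun p hp => ?_)
    rw [h p hp, eval_zero]
  have hfin : (H : Set QBarˣ).Finite := by
    refine Set.Finite.of_finite_image (f := Units.val) ?_ Units.val_injective.injOn
    refine (p.roots.toFinset.finite_toSet).subset ?_
    rintro _ ⟨y, hy, rfl⟩
    simpa [hp] using (hS y).1 hy p hpS
  have : Finite H := hfin
  obtain ⟨n, hn, hxn⟩ := (isOfFinOrder_of_finite (⟨x, hx⟩ : H)).exists_pow_eq_one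
  have h1 : ((x : QBar) : ℂ) ^ n = 1 := by
    have : x ^ n = 1 := congrArg Subtype.val hxn
    simpa using congrArg (fun u : QBarˣ => ((u : QBar) : ℂ)) this
  exact Complex.norm_eq_one_of_pow_eq_one h1 hn.ne'

/-- The infimum of an empty set of naturals is 0, so a nonzero value is attained. -/
theorem theta_inv_le_of_dygReal_ne_zero {b : ℝ} (hb : b ≠ Real.goldenRatio) (h0 : dygReal b ≠ 0) :
    3 ≤ dygReal b ∧ (theta (dygReal b))⁻¹ ≤ b := by
  unfold dygReal at h0 ⊢
  rw [if_neg hb] at h0 ⊢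
  have := Nat.sInf_mem (Nat.nonempty_of_pos_sInf (Nat.pos_of_ne_zero h0))
  exact ⟨this.1, this.2.1⟩

/-- For `n ≤ N` the finitely many thresholds `θ_n⁻¹` all exceed 1, so `b q` eventually lies below
each of them. -/
theorem tendsto_dygReal_atTop {b : ℕ → ℝ} (hb : Tendsto b atTop (𝓝 1))
    (hdyg : ∀ q, 3 ≤ dygReal (b q)) : Tendsto (fun q => dygReal (b q)) atTop atTop := by
  refine tendsto_atTop.2 fun N => ?_
  have hev : ∀ᶠ q in atTop, ∀ n ∈ Finset.Icc 1 N, b q < (theta n)⁻¹ := by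
    rw [Finset.eventually_all]
    intro n hn
    have h := (theta_spec n (Finset.mem_Icc.1 hn).1).1
    exact hb.eventually_lt_const ((one_lt_inv₀ h.1).2 h.2)
  filter_upwards [hev] with q hq
  by_contra! hlt
  have hne : b q ≠ Real.goldenRatio := by
    intro h
    have := hdyg q
    rw [dygReal, if_pos h] at this
    omega
  have h3 := hdyg q
  have h := theta_inv_le_of_dygReal_ne_zero hne (by omega)
  exact (hq _ (Finset.mem_Icc.2 ⟨by omega, hlt.le⟩)).not_ge h.2

/-- Algebraic integers of bounded Mahler measure and of degree tending to infinity have Galois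
orbits that are equidistributed on the unit circle. -/
theorem tendsto_integral_galoisMeasure {a : ℕ → QBarˣ}
    (hint : ∀ q, IsIntegral ℤ ((a q : QBar) : ℂ)) {B : ℝ}
    (hB : ∀ q, mahler (a q : QBar) ≤ B)
    (hdeg : Tendsto (fun q => (minpoly ℚ ((a q : QBar) : ℂ)).natDegree) atTop atTop)
    (f : ℂˣ →ᵇ ℂ) :
    Tendsto (fun q => ∫ z, f z ∂(galoisMeasure (a q))) atTop (𝓝 (∫ z, f z ∂haarCircle)) := by
  classical
  have : ∀ q, FiniteDimensional ℚ ℚ⟮((a q : QBar) : ℂ)⟯ := fun q =>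
    finiteDimensional_adjoin (hint q)
  have hcard : Tendsto (fun q => Fintype.card (ℚ⟮((a q : QBar) : ℂ)⟯ →ₐ[ℚ] ℂ)) atTop atTop := by
    refine hdeg.congr fun q => ?_
    exact (card_embeddings (hint q)).symm
  refine (tendsto_average_boundedContinuousFunction hcard (fun q => conj (a q)) B
    (fun q => ?_) (fun q => ?_) (fun q => ?_) f).congr fun q => ?_
  · exact (sum_posLog_embeddings_le_mahler (hint q)).trans (hB q)
  · refine one_le_prod_norm_embeddings (hint q) fun h => (a q).ne_zero (Subtype.ext h)
  · exact one_le_prod_norm_sub_embeddings (hint q)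
  · exact (integral_galoisMeasure (a q) (hint q) f).symm

end SmallMahler

end

theorem theorem1p7 (α : ℕ → SmallMahler.QBarˣ)
    (hint : ∀ q, IsIntegral ℤ (((α q : SmallMahler.QBar)) : ℂ))
    (habs : ∀ q, 1 < ‖((α q : SmallMahler.QBar) : ℂ)‖)
    (hM : ∀ q, SmallMahler.mahler (α q : SmallMahler.QBar) < SmallMahler.smallestPisot)
    (hdyg : ∀ q, 260 ≤ SmallMahler.dyg (α q : SmallMahler.QBar))
    (hhouse : Tendsto (fun q => SmallMahler.house (α q : SmallMahler.QBar)) atTop (𝓝 1)) :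
    SmallMahler.IsStrict α ∧
    Tendsto (fun q => SmallMahler.dyg (α q : SmallMahler.QBar)) atTop atTop ∧
    ∀ f : ℂˣ →ᵇ ℂ,
      Tendsto (fun q => ∫ z, f z ∂(SmallMahler.galoisMeasure (α q))) atTop
        (𝓝 (∫ z, f z ∂SmallMahler.haarCircle)) := by
  refine ⟨fun H hH htop => ?_, ?_, fun f => ?_⟩
  · convert Set.finite_empty
    refine Set.eq_empty_of_forall_notMem fun q hq => ?_
    exact (habs q).ne' (SmallMahler.norm_eq_one_of_mem_isAlgebraicSubgroup hH htop hq)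
  · exact SmallMahler.tendsto_dygReal_atTop hhouse fun q => le_trans (by norm_num) (hdyg q)
  · exact SmallMahler.tendsto_integral_galoisMeasure hint (fun q => (hM q).le)
      (SmallMahler.tendsto_natDegree_minpoly hint habs (fun q => (hM q).le) hhouse) f
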